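/- Let $H$ be a complex Hilbert space and let $A,B$ be bounded operators on $H$. Write $\dot T$ for the class of an operator $T$ modulo compact operators, with the quotient norm. Suppose $(A,B)$ is balanced modulo compacts: $\|\dot A\|\le 1$, $\|\dot B\|\le 1$, and modulo compact operators $$A^*A=B^*B,\quad AA^*=BB^*,\quad A(1-A^*A)=B(1-B^*B),\quad (1-AA^*)A=(1-BB^*)B .$$ For $\varepsilon>0$, an $\varepsilon$-decomposition for $(A,B)$ is an orthogonal decomposition $H=H_1\oplus H_2$ into closed subspaces such that, writing operators as $2\times 2$ matrices, (1) $\|A_{ij}-B_{ij}\|<\varepsilon$ for all $(i,j)\ne(1,1)$; (2) for each $T\in\{1-A^*A,\,1-AA^*,\,1-B^*B,\,1-BB^*\}$ and each $(i,j)\neq(2,2)$, $T_{ij}=D+K$ with $\|D\|<\varepsilon$ and $K$ compact. Given an $\varepsilon$-decomposition, write $X_1=X_{11}$, $X_2=X_{21}$ for the components of $X|_{H_1}:H_1\to H_1\oplus H_2$. An auxiliary operator is a bounded operator $C=\binom{C_1}{C_2}:H_1\to H_1\oplus H_2$ such that, for both $X=A$ and $X=B$, - (C1) $\|C_2-X_2\|<\varepsilon$;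 - (C2) $\|\dot C_1^*\dot C_1-\dot X_1^*\dot X_1\|<2\varepsilon$ and $\|\dot C_1\dot C_1^*-\dot X_1\dot X_1^*\|<2\varepsilon$; - (C3) $\|(\dot C_1-\dot X_1)(1-\dot X_1^*\dot X_1)\|<4\varepsilon$ and $\|(\dot C_1-\dot X_1)^*(1-\dot X_1\dot X_1^*)\|<4\varepsilon$. Then the following hold. 1. For every $\varepsilon\in(0,1/20)$ and every $\varepsilon$-decomposition, $A|_{H_1}$ and $B|_{H_1}$ are auxiliary operators, and for every auxiliary operator $C$ the operators $C^*\circ A|_{H_1}$ and $C^*\circ B|_{H_1}$ on $H_1$ are Fredholm. 2. The relative index $\operatorname{ind}(A,B)=\operatorname{ind}(C^*\circ A|_{H_1})-\operatorname{ind}(C^*\circ B|_{H_1})$ depends neither on the auxiliary operator $C$ nor on the decomposition: any two choices of $\varepsilon\in(0,1/20)$, an $\varepsilon$-decomposition and an auxiliary operator give the same value. 3. The operator $1+B^*(A-B)$ on $H$ is Fredholm, and $\operatorname{ind}(A,B)=\operatorname{ind}(1+B^*(A-B))$ for every such choice. -/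

import Mathlib

open scoped InnerProductSpace

noncomputable section

namespace BalancedPair

/-- Bounded operators `E → F` modulo compact operators, with the quotient norm.
For `E = F = H` this is the Calkin algebra of `H`. -/
abbrev Calkin (E F : Type*) [NormedAddCommGroup E] [NormedSpace ℂ E]
    [NormedAddCommGroup F] [NormedSpace ℂ F] : Type _ :=
  (E →L[ℂ] F) ⧸ compactOperator (RingHom.id ℂ) E F

/-- The class of an operator modulo compact operators. Since products and adjoints of classes are
the classes of products and adjoints, an algebraic expression in classes is written below as the
class of the same expression in the operators. -/
def dot {E F : Type*} [NormedAddCommGroup E] [NormedSpace ℂ E]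
    [NormedAddCommGroup F] [NormedSpace ℂ F] (T : E →L[ℂ] F) : Calkin E F :=
  Submodule.Quotient.mk T

/-- `T = D + K` with `‖D‖ < ε` and `K` compact. -/
def IsSmallPlusCompact {E F : Type*} [NormedAddCommGroup E] [NormedSpace ℂ E]
    [NormedAddCommGroup F] [NormedSpace ℂ F] (ε : ℝ) (T : E →L[ℂ] F) : Prop :=
  ∃ D K : E →L[ℂ] F, T = D + K ∧ ‖D‖ < ε ∧ IsCompactOperator K

variable {H : Type*} [NormedAddCommGroup H] [InnerProductSpace ℂ H] [CompleteSpace H]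

/-- The pair `(A, B)` is balanced modulo compacts: the classes of `A` and `B` in the Calkin algebra
are contractions with `a*a = b*b`, `aa* = bb*`, `a(1 - a*a) = b(1 - b*b)` and
`(1 - aa*)a = (1 - bb*)b`. -/
structure IsKBalanced (A B : H →L[ℂ] H) : Prop where
  norm_left : ‖dot A‖ ≤ 1
  norm_right : ‖dot B‖ ≤ 1
  star_mul : dot (star A * A) = dot (star B * B)
  mul_star : dot (A * star A) = dot (B * star B)
  mul_defect : dot (A * (1 - star A * A)) = dot (B * (1 - star B * B))
  defect_mul : dot ((1 - A * star A) * A) = dot ((1 - B * star B) * B)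

/-- The matrix entry `W → V` of `T`, i.e. the compression `P_V T|_W`. -/
def block (V W : Submodule ℂ H) [V.HasOrthogonalProjection] (T : H →L[ℂ] H) : W →L[ℂ] V :=
  V.orthogonalProjectionOnto ∘L T ∘L W.subtypeL

/-- The orthogonal decomposition `H = H₁ ⊕ H₂` with `H₁ = U`, `H₂ = Uᗮ` is an `ε`-decomposition for
`(A, B)`: all entries of `A - B` other than the `(1,1)` entry are smaller than `ε`, and all entries
of the four defect operators other than the `(2,2)` entry are smaller than `ε` up to a compact
summand. -/
structure IsDecomposition (A B : H →L[ℂ] H) (ε : ℝ) (U : Submodule ℂ H) [CompleteSpace U] :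
    Prop where
  close₁₂ : ‖block U Uᗮ A - block U Uᗮ B‖ < ε
  close₂₁ : ‖block Uᗮ U A - block Uᗮ U B‖ < ε
  close₂₂ : ‖block Uᗮ Uᗮ A - block Uᗮ Uᗮ B‖ < ε
  defect : ∀ T ∈ ({1 - star A * A, 1 - A * star A, 1 - star B * B, 1 - B * star B} :
      Set (H →L[ℂ] H)),
    IsSmallPlusCompact ε (block U U T) ∧
    IsSmallPlusCompact ε (block U Uᗮ T) ∧
    IsSmallPlusCompact ε (block Uᗮ U T)

/-- The restriction `T|_U : U → H`. -/
def restr (U : Submodule ℂ H) (T : H →L[ℂ] H) : U →L[ℂ] H := T ∘L U.subtypeL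

/-- The first component `C₁ : U → U` of `C : U → H = U ⊕ Uᗮ`. -/
def fstComp (U : Submodule ℂ H) [CompleteSpace U] (C : U →L[ℂ] H) : U →L[ℂ] U :=
  U.orthogonalProjectionOnto ∘L C

/-- The second component `C₂ : U → Uᗮ` of `C : U → H = U ⊕ Uᗮ`. -/
def sndComp (U : Submodule ℂ H) [CompleteSpace U] (C : U →L[ℂ] H) : U →L[ℂ] Uᗮ :=
  Uᗮ.orthogonalProjectionOnto ∘L C

/-- The conditions on the operator `C : U → H` with respect to one operator `X : U → H`, in terms
of the components `C = (C₁, C₂)` and `X = (X₁, X₂)`. -/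
structure IsAdmissibleFor (ε : ℝ) (U : Submodule ℂ H) [CompleteSpace U] (X C : U →L[ℂ] H) :
    Prop where
  snd_close : ‖sndComp U C - sndComp U X‖ < ε
  star_mul_close : ‖dot (star (fstComp U C) * fstComp U C -
    star (fstComp U X) * fstComp U X)‖ < 2 * ε
  mul_star_close : ‖dot (fstComp U C * star (fstComp U C) -
    fstComp U X * star (fstComp U X))‖ < 2 * ε
  defect_close : ‖dot ((fstComp U C - fstComp U X) *
    (1 - star (fstComp U X) * fstComp U X))‖ < 4 * ε
  star_defect_close : ‖dot (star (fstComp U C - fstComp U X) *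
    (1 - fstComp U X * star (fstComp U X)))‖ < 4 * ε

/-- `C : U → H` is an auxiliary operator for the pair `(A, B)`: the conditions hold with respect to
both `X = A|_U` and `X = B|_U`. -/
def IsAuxiliary (A B : H →L[ℂ] H) (ε : ℝ) (U : Submodule ℂ H) [CompleteSpace U]
    (C : U →L[ℂ] H) : Prop :=
  IsAdmissibleFor ε U (restr U A) C ∧ IsAdmissibleFor ε U (restr U B) C

/-- The operator `C* ∘ T|_U` on `U`. -/
def compressed (U : Submodule ℂ H) [CompleteSpace U] (C : U →L[ℂ] H) (T : H →L[ℂ] H) :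
    U →L[ℂ] U :=
  ContinuousLinearMap.adjoint C ∘L restr U T

/-- The Fredholm index `dim ker T - dim coker T`. -/
def ind {E : Type*} [NormedAddCommGroup E] [NormedSpace ℂ E] (T : E →L[ℂ] E) : ℤ :=
  LinearMap.index (T : E →ₗ[ℂ] E)

/-- The relative index of `(A, B)`, computed from the decomposition `H = U ⊕ Uᗮ` and the auxiliary
operator `C`. -/
def relInd (A B : H →L[ℂ] H) (U : Submodule ℂ H) [CompleteSpace U] (C : U →L[ℂ] H) : ℤ :=
  ind (compressed U C A) - ind (compressed U C B)

end BalancedPair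

end

/-!
# The relative index of a pair balanced modulo compact operators

All estimates take place in the Calkin algebra, which is shown to be a C⋆-ring. Let `a`, `b` be the
classes of `A`, `B`. The balancing relations make `z = 1 + b⋆(a - b)` unitary and give `b z = a`
(`IsBalanced.star_mul_unitary`, `IsBalanced.mul_unitary`). Hence `1 + B⋆(A - B)` is Fredholm. For an
`ε`-decomposition with projection `p` onto `U`, the entries of `z - 1` outside the corner of `p` are
of order `ε`. So up to errors of order `ε`, `c⋆a p ≈ c⋆b p · (p z p)` for the class `c` of an
auxiliary operator, and `p z p + (1 - p) ≈ z`. Once the compressed operators are known to be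
invertible in the Calkin algebra with a bound on the inverse, this gives
`ind (C⋆A|_U) = ind (C⋆B|_U) + ind (1 + B⋆(A - B))`, from which both the formula for the relative
index and its independence of all choices follow.

The required invertibility is quantitative. With `x` and `c₁` the `(1,1)` entries of `a` and `c`,
the operator `w = c₁⋆x + (1 - x⋆x)` (`parametrix`) satisfies `‖w⋆w - 1‖ ≤ 10ε` and `‖ww⋆ - 1‖ < 1`,
and it is `2ε`-close to `c⋆a p + (1 - p)`. Therefore `w⋆` serves as an approximate inverse for all
operators in question (`norm_star_parametrix_mul_compressed_sub_one_le`,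
`norm_star_parametrix_mul_compressed_mul_corner_sub_one_lt`).

Passing from such estimates to the index uses one fact (`isFredholm_and_ind_eq_zero`): an operator
whose class is at distance less than `1` from the identity is the product of an invertible operator
and a finite rank perturbation of the identity, so it is Fredholm of index zero. Operators on `U`
are treated as operators on `H` extended by the identity on `Uᗮ` (`isFredholm_and_ind_of_extend`).
-/

open scoped InnerProductSpace

noncomputable section

namespace BalancedPair

/-! ### Compact operators on Hilbert spaces -/

section Compact

variable {E F : Type*} [NormedAddCommGroup E] [InnerProductSpace ℂ E]
  [NormedAddCommGroup F] [InnerProductSpace ℂ F]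

/-- A compact operator into a Hilbert space is approximated in norm by its compressions to
finite-dimensional subspaces. -/
lemma exists_norm_sub_starProjection_comp_le {K : E →L[ℂ] F} (hK : IsCompactOperator K) {δ : ℝ}
    (hδ : 0 < δ) : ∃ (V : Submodule ℂ F) (_ : FiniteDimensional ℂ V),
      ‖K - V.starProjection ∘L K‖ ≤ δ := by
  have hT := (IsCompactOperator.isCompact_closure_image_closedBall (f := (K : E →ₗ[ℂ] F))
    hK 1).totallyBounded
  obtain ⟨t, ht, hcov⟩ := Metric.totallyBounded_iff.1 hT δ hδ
  have hfd : FiniteDimensional ℂ (Submodule.span ℂ t) := FiniteDimensional.span_of_finite ℂ ht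
  refine ⟨Submodule.span ℂ t, hfd, ?_⟩
  refine ContinuousLinearMap.opNorm_le_of_unit_norm hδ.le fun x hx => ?_
  have hmem : K x ∈ closure ((K : E →ₗ[ℂ] F) '' Metric.closedBall 0 1) :=
    subset_closure ⟨x, by simp [hx], rfl⟩
  obtain ⟨y, hy, hxy⟩ := Set.mem_iUnion₂.1 (hcov hmem)
  calc ‖(K - (Submodule.span ℂ t).starProjection ∘L K) x‖
      = ‖K x - (Submodule.span ℂ t).starProjection (K x)‖ := rfl
    _ = ⨅ w : Submodule.span ℂ t, ‖K x - w‖ := Submodule.starProjection_minimal _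
    _ ≤ ‖K x - (⟨y, Submodule.subset_span hy⟩ : Submodule.span ℂ t)‖ :=
        ciInf_le ⟨0, by rintro _ ⟨w, rfl⟩; positivity⟩ _
    _ ≤ δ := by rw [← dist_eq_norm]; exact hxy.le

lemma isCompactOperator_starProjection (V : Submodule ℂ F) [FiniteDimensional ℂ V] :
    IsCompactOperator V.starProjection := by
  have : IsCompactOperator (V.orthogonalProjectionOnto) :=
    isCompactOperator_of_locallyCompactSpace_dom _
  exact this.clm_comp V.subtypeL

/-- The adjoint of a compact operator between Hilbert spaces is compact. -/
lemma _root_.IsCompactOperator.adjoint [CompleteSpace E] [CompleteSpace F] {K : E →L[ℂ] F}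
    (hK : IsCompactOperator K) :
    IsCompactOperator (ContinuousLinearMap.adjoint K) := by
  have hcl : IsClosed {f : F →L[ℂ] E | IsCompactOperator f} := isClosed_setOfPred_isCompactOperator
  have : ContinuousLinearMap.adjoint K ∈ {f : F →L[ℂ] E | IsCompactOperator f} := by
    rw [← hcl.closure_eq, Metric.mem_closure_iff]
    intro ε hε
    obtain ⟨V, _, hV⟩ := exists_norm_sub_starProjection_comp_le hK (half_pos hε)
    refine ⟨ContinuousLinearMap.adjoint K ∘L V.starProjection,
      (isCompactOperator_starProjection V).clm_comp (ContinuousLinearMap.adjoint K), ?_⟩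
    have h : ContinuousLinearMap.adjoint K - ContinuousLinearMap.adjoint K ∘L V.starProjection =
        ContinuousLinearMap.adjoint (K - V.starProjection ∘L K) := by
      rw [map_sub, ContinuousLinearMap.adjoint_comp,
        (isSelfAdjoint_starProjection V).adjoint_eq]
    rw [dist_eq_norm, h, LinearIsometryEquiv.norm_map]
    linarith
  exact this

end Compact

/-! ### The essential norm -/

section EssentialNorm

variable {E F G : Type*} [NormedAddCommGroup E] [NormedSpace ℂ E]
  [NormedAddCommGroup F] [NormedSpace ℂ F] [NormedAddCommGroup G] [NormedSpace ℂ G]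

lemma dot_eq_dot_iff {S T : E →L[ℂ] F} : dot S = dot T ↔ IsCompactOperator (S - T) :=
  Submodule.Quotient.eq _

lemma norm_dot_le (T : E →L[ℂ] F) : ‖dot T‖ ≤ ‖T‖ := Submodule.Quotient.norm_mk_le _ _

lemma norm_dot_lt_iff {T : E →L[ℂ] F} {r : ℝ} : ‖dot T‖ < r ↔ IsSmallPlusCompact r T := by
  constructor
  · intro h
    obtain ⟨D, hD, hn⟩ := QuotientAddGroup.norm_lt_iff.1 h
    exact ⟨D, T - D, by abel, hn, (dot_eq_dot_iff (S := T) (T := D)).1 (Eq.symm hD)⟩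
  · rintro ⟨D, K, rfl, hD, hK⟩
    have : dot (D + K) = dot D := dot_eq_dot_iff.2 (by simpa using hK)
    rw [this]
    exact (norm_dot_le D).trans_lt hD

lemma norm_dot_comp_le (S : F →L[ℂ] G) (T : E →L[ℂ] F) : ‖dot (S ∘L T)‖ ≤ ‖S‖ * ‖dot T‖ := by
  refine le_of_forall_pos_lt_add fun ε hε => ?_
  have hS : 0 < ‖S‖ + 1 := by positivity
  obtain ⟨D, K, h, hD, hK⟩ := norm_dot_lt_iff.1
    (lt_add_of_pos_right ‖dot T‖ (div_pos hε hS))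
  refine norm_dot_lt_iff.2 ⟨S ∘L D, S ∘L K, by rw [h]; simp, ?_, hK.clm_comp S⟩
  calc ‖S ∘L D‖ ≤ ‖S‖ * ‖D‖ := ContinuousLinearMap.opNorm_comp_le _ _
    _ ≤ ‖S‖ * (‖dot T‖ + ε / (‖S‖ + 1)) := by gcongr
    _ = ‖S‖ * ‖dot T‖ + ε * (‖S‖ / (‖S‖ + 1)) := by ring
    _ < ‖S‖ * ‖dot T‖ + ε * 1 := by
        gcongr
        rw [div_lt_one hS]; linarith
    _ = _ := by ring

lemma norm_dot_comp_le' (S : F →L[ℂ] G) (T : E →L[ℂ] F) : ‖dot (S ∘L T)‖ ≤ ‖dot S‖ * ‖T‖ := by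
  refine le_of_forall_pos_lt_add fun ε hε => ?_
  have hS : 0 < ‖T‖ + 1 := by positivity
  obtain ⟨D, K, h, hD, hK⟩ := norm_dot_lt_iff.1
    (lt_add_of_pos_right ‖dot S‖ (div_pos hε hS))
  refine norm_dot_lt_iff.2 ⟨D ∘L T, K ∘L T, by rw [h]; simp, ?_, hK.comp_clm T⟩
  calc ‖D ∘L T‖ ≤ ‖D‖ * ‖T‖ := ContinuousLinearMap.opNorm_comp_le _ _
    _ ≤ (‖dot S‖ + ε / (‖T‖ + 1)) * ‖T‖ := by gcongr
    _ = ‖dot S‖ * ‖T‖ + ε * (‖T‖ / (‖T‖ + 1)) := by ring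
    _ < ‖dot S‖ * ‖T‖ + ε * 1 := by
        gcongr
        rw [div_lt_one hS]; linarith
    _ = _ := by ring

end EssentialNorm

/-! ### The Calkin algebra as a C⋆-ring -/

section CalkinAlgebra

variable {H : Type*} [NormedAddCommGroup H] [InnerProductSpace ℂ H]

lemma dot_surjective : Function.Surjective (dot : (H →L[ℂ] H) → Calkin H H) :=
  Submodule.Quotient.mk_surjective _

instance : Mul (Calkin H H) where
  mul := Quotient.map₂ (· * ·) fun S S' hS T T' hT => by
    refine (Submodule.quotientRel_def _).2 ?_
    have h : S * T - S' * T' = (S - S') * T + S' * (T - T') := by noncomm_ring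
    rw [h]
    exact (IsCompactOperator.comp_clm ((Submodule.quotientRel_def _).1 hS) T).add
      (IsCompactOperator.clm_comp ((Submodule.quotientRel_def _).1 hT) S')

instance : One (Calkin H H) := ⟨dot 1⟩

lemma dot_mul (S T : H →L[ℂ] H) : dot (S * T) = dot S * dot T := rfl
lemma dot_one : dot (1 : H →L[ℂ] H) = 1 := rfl
lemma dot_add (S T : H →L[ℂ] H) : dot (S + T) = dot S + dot T := rfl
lemma dot_sub (S T : H →L[ℂ] H) : dot (S - T) = dot S - dot T := rfl

instance : Ring (Calkin H H) :=
  { (inferInstance : AddCommGroup (Calkin H H)) with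
    mul := (· * ·)
    one := 1
    left_distrib := by
      rintro ⟨x⟩ ⟨y⟩ ⟨z⟩
      exact congrArg dot (mul_add x y z)
    right_distrib := by
      rintro ⟨x⟩ ⟨y⟩ ⟨z⟩
      exact congrArg dot (add_mul x y z)
    zero_mul := by
      rintro ⟨x⟩
      exact congrArg dot (zero_mul x)
    mul_zero := by
      rintro ⟨x⟩
      exact congrArg dot (mul_zero x)
    mul_assoc := by
      rintro ⟨x⟩ ⟨y⟩ ⟨z⟩
      exact congrArg dot (mul_assoc x y z)
    one_mul := by
      rintro ⟨x⟩
      exact congrArg dot (one_mul x)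
    mul_one := by
      rintro ⟨x⟩
      exact congrArg dot (mul_one x) }

variable [CompleteSpace H]

instance : IsClosed ((compactOperator (RingHom.id ℂ) H H : Submodule ℂ (H →L[ℂ] H)) :
    Set (H →L[ℂ] H)) :=
  isClosed_setOfPred_isCompactOperator

instance : Star (Calkin H H) where
  star := Quotient.map star fun S T h => by
    refine (Submodule.quotientRel_def _).2 ?_
    rw [← star_sub]
    exact IsCompactOperator.adjoint ((Submodule.quotientRel_def _).1 h)

lemma dot_star (T : H →L[ℂ] H) : dot (star T) = star (dot T) := rfl

instance : NormedRing (Calkin H H) :=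
  { (inferInstance : Ring (Calkin H H)), (inferInstance : NormedAddCommGroup (Calkin H H)) with
    norm_mul_le := by
      intro x y
      obtain ⟨S, rfl⟩ := dot_surjective x
      obtain ⟨T, rfl⟩ := dot_surjective y
      refine le_of_forall_pos_lt_add fun ε hε => ?_
      have hT : 0 < ‖dot T‖ + 1 := by positivity
      obtain ⟨D, K, h, hD, hK⟩ := norm_dot_lt_iff.1
        (lt_add_of_pos_right ‖dot S‖ (div_pos hε hT))
      have hSD : dot S = dot D := dot_eq_dot_iff.2 (by rw [h]; simpa using hK)
      calc ‖dot S * dot T‖ = ‖dot (D ∘L T)‖ := by rw [hSD]; rfl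
        _ ≤ ‖D‖ * ‖dot T‖ := norm_dot_comp_le D T
        _ ≤ (‖dot S‖ + ε / (‖dot T‖ + 1)) * ‖dot T‖ := by gcongr
        _ = ‖dot S‖ * ‖dot T‖ + ε * (‖dot T‖ / (‖dot T‖ + 1)) := by ring
        _ < ‖dot S‖ * ‖dot T‖ + ε * 1 := by
            gcongr
            rw [div_lt_one hT]; linarith
        _ = _ := by ring }

instance : StarRing (Calkin H H) where
  star_involutive := by
    rintro ⟨x⟩
    exact congrArg dot (star_star x)
  star_mul := by
    rintro ⟨x⟩ ⟨y⟩
    exact congrArg dot (star_mul x y)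
  star_add := by
    rintro ⟨x⟩ ⟨y⟩
    exact congrArg dot (star_add x y)

/-- Cutting `T` down by the complement of a finite-dimensional space that almost absorbs the compact
part of `T⋆T` changes `T` by a finite rank operator and brings `‖T‖ ^ 2` down to the essential norm
of `T⋆T`. -/
instance : CStarRing (Calkin H H) where
  norm_mul_self_le := by
    intro x
    obtain ⟨T, rfl⟩ := dot_surjective x
    refine le_of_forall_pos_le_add fun ε hε => ?_
    obtain ⟨D, K, h, hD, hK⟩ := norm_dot_lt_iff.1
      (lt_add_of_pos_right ‖dot (star T * T)‖ (half_pos hε))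
    obtain ⟨V, _, hV⟩ := exists_norm_sub_starProjection_comp_le hK (half_pos hε)
    set P := V.starProjection with hP
    have hPs : star P = P := (isSelfAdjoint_starProjection V).star_eq
    have hQ : ‖1 - P‖ ≤ 1 := by
      rw [hP, ← Submodule.starProjection_orthogonal']
      exact Submodule.starProjection_norm_le _
    have hdot : dot T = dot (T * (1 - P)) := dot_eq_dot_iff.2 (by
      have : T - T * (1 - P) = T ∘L P := by rw [mul_sub, mul_one, sub_sub_cancel]; rfl
      rw [this]
      exact (isCompactOperator_starProjection V).clm_comp T)
    calc ‖dot T‖ * ‖dot T‖ = ‖dot (T * (1 - P))‖ * ‖dot (T * (1 - P))‖ := by rw [← hdot]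
      _ ≤ ‖T * (1 - P)‖ * ‖T * (1 - P)‖ :=
          mul_self_le_mul_self (norm_nonneg _) (norm_dot_le _)
      _ = ‖star (T * (1 - P)) * (T * (1 - P))‖ := CStarRing.norm_star_mul_self.symm
      _ = ‖((1 - P) * D + (K - P * K)) * (1 - P)‖ := by
          congr 1
          rw [star_mul, star_sub, star_one, hPs]
          calc (1 - P) * star T * (T * (1 - P)) = (1 - P) * (star T * T) * (1 - P) := by
                noncomm_ring
            _ = _ := by rw [h]; noncomm_ring
      _ ≤ ‖(1 - P) * D + (K - P * K)‖ * ‖1 - P‖ := norm_mul_le _ _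
      _ ≤ ‖(1 - P) * D + (K - P * K)‖ * 1 := by gcongr
      _ ≤ ‖1 - P‖ * ‖D‖ + ‖K - P * K‖ := by
          rw [mul_one]
          exact (norm_add_le _ _).trans (by gcongr; exact norm_mul_le _ _)
      _ ≤ 1 * (‖dot (star T * T)‖ + ε / 2) + ε / 2 := by
          gcongr
          exact hV
      _ = ‖star (dot T) * dot T‖ + ε := by rw [dot_mul, dot_star]; ring

end CalkinAlgebra

/-! ### Index and Fredholm theory -/

section Algebraic

variable {k V : Type*} [Field k] [AddCommGroup V] [Module k V]

/-- If `T` induces the identity on `V ⧸ R`, then `T` and its restriction to `R` have the same kernel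
and the same cokernel. -/
lemma index_eq_of_sub_self_mem {T : V →ₗ[k] V} {R : Submodule k V} (hT : ∀ v, T v - v ∈ R)
    (w : R →ₗ[k] R) (hw : ∀ x : R, T x = w x) : T.index = w.index := by
  have hker : T.ker = w.ker.map R.subtype := by
    ext v
    simp only [LinearMap.mem_ker, Submodule.mem_map, Submodule.subtype_apply]
    constructor
    · intro hv
      have hvR : v ∈ R := by simpa [hv] using hT v
      exact ⟨⟨v, hvR⟩, Subtype.ext (by rw [← hw]; exact hv), rfl⟩
    · rintro ⟨x, hx, rfl⟩
      rw [hw, hx]; rfl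
  have hle : w.range ≤ T.range.comap R.subtype := by
    rintro _ ⟨x, rfl⟩
    exact ⟨x, hw x⟩
  have hbij : Function.Bijective (w.range.mapQ T.range R.subtype hle) := by
    constructor
    · rw [← LinearMap.ker_eq_bot, Submodule.ker_mapQ, ← le_bot_iff, Submodule.map_le_iff_le_comap,
        Submodule.comap_bot, Submodule.ker_mkQ]
      rintro r ⟨v, hv⟩
      have hvR : v ∈ R := by
        have := R.sub_mem (hv ▸ r.2 : T v ∈ R) (hT v)
        simpa using this
      exact ⟨⟨v, hvR⟩, Subtype.ext (by rw [← hw]; exact hv)⟩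
    · intro y
      obtain ⟨v, rfl⟩ := Submodule.Quotient.mk_surjective _ y
      refine ⟨Submodule.Quotient.mk (-⟨T v - v, hT v⟩), ?_⟩
      rw [Submodule.mapQ_apply, Submodule.Quotient.eq]
      exact ⟨-v, by simp⟩
  rw [LinearMap.index_eq_finrank_sub, LinearMap.index_eq_finrank_sub, hker,
    (Submodule.equivMapOfInjective _ R.subtype_injective _).symm.finrank_eq,
    (LinearEquiv.ofBijective _ hbij).finrank_eq]

/-- A finite rank perturbation of the identity has index zero. -/
lemma index_one_add_of_hasFiniteRange {F : V →ₗ[k] V} (hF : F.HasFiniteRange) :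
    (LinearMap.id + F).index = 0 := by
  have : Module.Finite k F.range := Module.Finite.of_fg hF
  rw [index_eq_of_sub_self_mem (R := F.range) (fun v => ⟨v, by simp⟩)
    (LinearMap.id + F.rangeRestrict ∘ₗ F.range.subtype) (fun x => rfl),
    LinearMap.index_eq_of_finiteDimensional, sub_self]

end Algebraic

section Fredholm

open LinearMap.FiniteRangeSetoid

variable {H : Type*} [NormedAddCommGroup H] [InnerProductSpace ℂ H]

/-- An operator with a left and a right inverse modulo finite rank operators is Fredholm. -/
lemma isFredholm_of_mul_equiv {L T R : H →L[ℂ] H}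
    (hL : ((L * T : H →L[ℂ] H) : H →ₗ[ℂ] H) ≈ .id)
    (hR : ((T * R : H →L[ℂ] H) : H →ₗ[ℂ] H) ≈ .id) : T.IsFredholm := by
  have hL' : (L : H →ₗ[ℂ] H) ∘ₗ (T : H →ₗ[ℂ] H) ≈ .id := hL
  have hR' : (T : H →ₗ[ℂ] H) ∘ₗ (R : H →ₗ[ℂ] H) ≈ .id := hR
  have hLR : (L : H →ₗ[ℂ] H) ≈ (R : H →ₗ[ℂ] H) := by
    calc (L : H →ₗ[ℂ] H) = L ∘ₗ .id := rfl
      _ ≈ (L : H →ₗ[ℂ] H) ∘ₗ ((T : H →ₗ[ℂ] H) ∘ₗ (R : H →ₗ[ℂ] H)) := by grw [hR']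
      _ = ((L : H →ₗ[ℂ] H) ∘ₗ (T : H →ₗ[ℂ] H)) ∘ₗ (R : H →ₗ[ℂ] H) := rfl
      _ ≈ .id ∘ₗ (R : H →ₗ[ℂ] H) := by grw [hL']
      _ = R := rfl
  refine ContinuousLinearMap.IsFredholm.of_isQuasiInverse (v := L) ⟨hL', ?_⟩
  change (T : H →ₗ[ℂ] H) ∘ₗ (L : H →ₗ[ℂ] H) ≈ .id
  grw [hLR]
  exact hR'

lemma ind_mul {S T : H →L[ℂ] H} (hS : S.IsFredholm) (hT : T.IsFredholm) :
    ind (S * T) = ind S + ind T := by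
  have := hS.finite_ker
  have := hT.finite_ker
  have : FiniteDimensional ℂ (H ⧸ (S : H →ₗ[ℂ] H).range) := hS.finite_coker
  have : FiniteDimensional ℂ (H ⧸ (T : H →ₗ[ℂ] H).range) := hT.finite_coker
  exact LinearMap.index_comp (f := (T : H →ₗ[ℂ] H)) (S : H →ₗ[ℂ] H)

/-- Extending an operator `w` on `U` by the identity on `Uᗮ` changes neither its Fredholm property
nor its index. -/
lemma isFredholm_and_ind_of_extend {U : Submodule ℂ H} [CompleteSpace U] {T : H →L[ℂ] H}
    {w : U →L[ℂ] U} (hT : T = U.subtypeL ∘L w ∘L U.orthogonalProjectionOnto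
      + (1 - U.starProjection)) (hF : T.IsFredholm) : w.IsFredholm ∧ ind w = ind T := by
  have hTU : ∀ x : U, T x = w x := by
    intro x
    simp [hT]
  have hUT : ∀ x, U.orthogonalProjectionOnto (T x) = w (U.orthogonalProjectionOnto x) := by
    intro x
    have : U.orthogonalProjectionOnto (U.starProjection x) = U.orthogonalProjectionOnto x := by
      rw [Submodule.starProjection_apply, Submodule.orthogonalProjectionOnto_mem_subspace_eq_self]
    simp [hT, this]
  constructor
  · obtain ⟨S, hl, hr⟩ := hF.exists_isQuasiInverse
    refine .of_isQuasiInverse (v := U.orthogonalProjectionOnto ∘L S ∘L U.subtypeL) ⟨?_, ?_⟩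
    · have h := LinearMap.HasFiniteRange.comp_left (LinearMap.HasFiniteRange.comp_right
        (equiv_iff_hasFiniteRange.1 hl) U.subtype) U.orthogonalProjectionOnto.toLinearMap
      refine equiv_iff_hasFiniteRange.2 ?_
      convert! h using 1
      ext x
      simp [hTU]
    · have h := LinearMap.HasFiniteRange.comp_left (LinearMap.HasFiniteRange.comp_right
        (equiv_iff_hasFiniteRange.1 hr) U.subtype) U.orthogonalProjectionOnto.toLinearMap
      refine equiv_iff_hasFiniteRange.2 ?_
      convert! h using 1
      ext x
      simp [hUT]
  · refine (index_eq_of_sub_self_mem (R := U) (fun v => ?_) _ fun x => hTU x).symm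
    have : T v - v = (w (U.orthogonalProjectionOnto v) : H) - U.starProjection v := by
      simp [hT]
      abel
    change T v - v ∈ U
    rw [this]
    exact U.sub_mem (Subtype.property _) (Submodule.starProjection_apply_mem _ _)

variable [CompleteSpace H]

/-- An operator at essential distance less than `1` from the identity is the product of an
invertible operator and a finite rank perturbation of the identity. -/
lemma isFredholm_and_ind_eq_zero {X : H →L[ℂ] H} (hX : ‖dot X - 1‖ < 1) :
    X.IsFredholm ∧ ind X = 0 := by
  obtain ⟨D, K, h, hD, hK⟩ := norm_dot_lt_iff.1 (show ‖dot (X - 1)‖ < 1 from hX)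
  obtain ⟨V, _, hV⟩ := exists_norm_sub_starProjection_comp_le hK (half_pos (sub_pos.2 hD))
  set F : H →L[ℂ] H := V.starProjection ∘L K with hF
  have hFr : (F : H →ₗ[ℂ] H).HasFiniteRange := by
    have h1 : (V.orthogonalProjectionOnto ∘L K : H →ₗ[ℂ] V).HasFiniteRange := by simp
    exact h1.comp_left V.subtype
  have hu : IsUnit (1 - -(D + (K - F))) := by
    refine isUnit_one_sub_of_norm_lt_one ?_
    rw [norm_neg]
    linarith [norm_add_le D (K - F)]
  obtain ⟨u, hu⟩ := hu
  have hXu : X = u + F := by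
    rw [hu, sub_eq_iff_eq_add.1 h]; abel
  have huX : ((u⁻¹ : (H →L[ℂ] H)ˣ) : H →L[ℂ] H) * X =
      1 + ((u⁻¹ : (H →L[ℂ] H)ˣ) : H →L[ℂ] H) * F := by
    rw [hXu, mul_add, u.inv_mul]
  have hXu' : X * ((u⁻¹ : (H →L[ℂ] H)ˣ) : H →L[ℂ] H) =
      1 + F * ((u⁻¹ : (H →L[ℂ] H)ˣ) : H →L[ℂ] H) := by
    rw [hXu, add_mul, u.mul_inv]
  have hX' : X.IsFredholm := by
    refine isFredholm_of_mul_equiv (L := (u⁻¹ : (H →L[ℂ] H)ˣ)) (R := (u⁻¹ : (H →L[ℂ] H)ˣ)) ?_ ?_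
    · rw [huX, equiv_iff_hasFiniteRange]
      convert! hFr.comp_left ((u⁻¹ : (H →L[ℂ] H)ˣ) : H →L[ℂ] H).toLinearMap using 1
      ext x; simp
    · rw [hXu', equiv_iff_hasFiniteRange]
      convert! hFr.comp_right ((u⁻¹ : (H →L[ℂ] H)ˣ) : H →L[ℂ] H).toLinearMap using 1
      ext x; simp
  refine ⟨hX', ?_⟩
  have hiF : ((u⁻¹ : (H →L[ℂ] H)ˣ) : H →L[ℂ] H).IsFredholm := by
    refine isFredholm_of_mul_equiv (L := u) (R := u) ?_ ?_
    · rw [u.mul_inv]; exact Setoid.refl _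
    · rw [u.inv_mul]; exact Setoid.refl _
  have hu0 : ind ((u⁻¹ : (H →L[ℂ] H)ˣ) : H →L[ℂ] H) = 0 :=
    LinearEquiv.index_eq_zero (e := (ContinuousLinearEquiv.ofUnit u⁻¹).toLinearEquiv)
  have h1 : ind (1 + ((u⁻¹ : (H →L[ℂ] H)ˣ) : H →L[ℂ] H) * F) = 0 :=
    index_one_add_of_hasFiniteRange (hFr.comp_left _)
  rwa [← huX, ind_mul hiF hX', hu0, zero_add] at h1

/-- Atkinson's criterion: an operator that is invertible modulo compact operators, up to errors of
essential norm less than `1`, is Fredholm. -/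
lemma isFredholm_of_norm_lt_one {T R : H →L[ℂ] H} (h₁ : ‖dot R * dot T - 1‖ < 1)
    (h₂ : ‖dot T * dot R - 1‖ < 1) : T.IsFredholm := by
  obtain ⟨L, hL⟩ := (isFredholm_and_ind_eq_zero (X := R * T) h₁).1.exists_isQuasiInverse
  obtain ⟨M, hM⟩ := (isFredholm_and_ind_eq_zero (X := T * R) h₂).1.exists_isQuasiInverse
  exact isFredholm_of_mul_equiv (L := L * R) (R := R * M) hL.1 hM.2

/-- An approximate right inverse, modulo compact operators, of a Fredholm operator `R` is Fredholm,
and its index is determined by `R`. -/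
lemma isFredholm_and_ind_eq_neg {R S : H →L[ℂ] H} (hR : R.IsFredholm)
    (h : ‖dot R * dot S - 1‖ < 1) : S.IsFredholm ∧ ind S = -ind R := by
  obtain ⟨hX, h0⟩ := isFredholm_and_ind_eq_zero (X := R * S) h
  obtain ⟨R', hR'⟩ := hR.exists_isQuasiInverse
  obtain ⟨X', hX'⟩ := hX.exists_isQuasiInverse
  have hS : S.IsFredholm := .of_isQuasiInverse (v := X' * R)
    (LinearMap.IsQuasiInverse.of_comp_right (v := (R : H →ₗ[ℂ] H)) hR' hX')
  refine ⟨hS, ?_⟩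
  rw [ind_mul hR hS] at h0
  omega

end Fredholm

/-! ### Balanced pairs in a C⋆-ring -/

lemma norm_mul_mul_le {R : Type*} [SeminormedRing R] {x y z : R} {r : ℝ}
    (hx : ‖x‖ ≤ 1) (hy : ‖y‖ ≤ r) (hz : ‖z‖ ≤ 1) :
    ‖x * y * z‖ ≤ r := by
  simpa using norm_mul_le_of_le (norm_mul_le_of_le hx hy) hz

section CStar

variable {Q : Type*} [NormedRing Q] [StarRing Q]

/-- `(a, b)` is a balanced pair in a C⋆-ring. -/
structure IsBalanced (a b : Q) : Prop where
  norm_left : ‖a‖ ≤ 1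
  norm_right : ‖b‖ ≤ 1
  star_mul_self : star a * a = star b * b
  mul_star_self : a * star a = b * star b
  mul_defect : a * (1 - star a * a) = b * (1 - star b * b)
  defect_mul : (1 - a * star a) * a = (1 - b * star b) * b

/-- The bounds of an `ε`-decomposition for `(a, b)`, where the projection `p` takes the place of the
decomposition. The bounds for the defects of `b` and for the remaining off-diagonal entries are
omitted: they follow for a balanced pair. -/
structure IsProjDecomposition (a b : Q) (ε : ℝ) (p : Q) : Prop where
  close₁₂ : ‖p * (a - b) * (1 - p)‖ < ε
  close₂₁ : ‖(1 - p) * (a - b) * p‖ < ε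
  close₂₂ : ‖(1 - p) * (a - b) * (1 - p)‖ < ε
  defect₁₁ : ‖p * (1 - star a * a) * p‖ < ε
  defect₂₁ : ‖(1 - p) * (1 - star a * a) * p‖ < ε
  defect₁₁' : ‖p * (1 - a * star a) * p‖ < ε
  defect₂₁' : ‖(1 - p) * (1 - a * star a) * p‖ < ε

variable {a b p : Q} {ε : ℝ}

/-- The key identity: right multiplication of `b` by `1 + b⋆(a - b)` gives `a`. -/
lemma IsBalanced.mul_unitary (h : IsBalanced a b) : b * (1 + star b * (a - b)) = a := by
  have h1 := h.defect_mul
  rw [h.mul_star_self] at h1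
  rw [← sub_eq_zero, ← sub_eq_zero.2 h1.symm]
  noncomm_ring

lemma IsBalanced.star_mul_unitary (h : IsBalanced a b) :
    star (1 + star b * (a - b)) * (1 + star b * (a - b)) = 1 := by
  have h1 := h.mul_defect
  have h2 := h.mul_unitary
  have hs := h.star_mul_self
  set z := 1 + star b * (a - b) with hz
  have hz' : z = 1 - star b * b + star b * a := by rw [hz]; noncomm_ring
  have h3 : star z * (1 - star b * b) = 1 - star b * b := by
    have : star z = 1 - star b * b + star a * b := by rw [hz']; simp
    rw [this, add_mul, mul_assoc, ← h1, ← mul_assoc, hs]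
    noncomm_ring
  calc star z * z = star z * (1 - star b * b) + star (b * z) * a := by
        rw [star_mul, mul_assoc, ← mul_add, ← hz']
    _ = 1 := by rw [h3, h2, hs]; noncomm_ring

lemma IsBalanced.unitary_mul_star (h : IsBalanced a b) :
    (1 + star b * (a - b)) * star (1 + star b * (a - b)) = 1 := by
  have h1 := h.mul_defect
  have hs := h.star_mul_self
  rw [hs] at h1
  have h2 : (1 - star b * b) * star a = (1 - star b * b) * star b := by
    simpa using congrArg star h1
  have hm := h.mul_star_self
  have hz : 1 + star b * (a - b) = 1 - star b * b + star b * a := by noncomm_ring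
  set d := 1 - star b * b with hd
  have hds : star d = d := by simp [hd]
  rw [hz, star_add, hds, star_mul, star_star]
  calc (d + star b * a) * (d + star a * b)
      = d * d + d * star a * b + star b * (a * d)
        + star b * (a * star a) * b := by noncomm_ring
    _ = 1 := by rw [h1, h2, hm, hd]; noncomm_ring

variable [CStarRing Q]

lemma IsBalanced.conj (h : IsBalanced a b) : IsBalanced (star a) (star b) where
  norm_left := by rw [norm_star]; exact h.norm_left
  norm_right := by rw [norm_star]; exact h.norm_right
  star_mul_self := by simpa using h.mul_star_self
  mul_star_self := by simpa using h.star_mul_self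
  mul_defect := by simpa using congrArg star h.defect_mul
  defect_mul := by simpa using congrArg star h.mul_defect

lemma IsProjDecomposition.conj (hp : IsStarProjection p) (hd : IsProjDecomposition a b ε p) :
    IsProjDecomposition (star a) (star b) ε p := by
  have hps : star p = p := hp.isSelfAdjoint.star_eq
  constructor
  · rw [← norm_star]; simpa [hps, mul_assoc] using hd.close₂₁
  · rw [← norm_star]; simpa [hps, mul_assoc] using hd.close₁₂
  · rw [← norm_star]; simpa [hps, mul_assoc] using hd.close₂₂
  · simpa using hd.defect₁₁'
  · simpa using hd.defect₂₁'
  · simpa using hd.defect₁₁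
  · simpa using hd.defect₂₁

lemma norm_le_one_of_isStarProjection (hp : IsStarProjection p) : ‖p‖ ≤ 1 := by
  have h : ‖p‖ * ‖p‖ = ‖p‖ := by
    rw [← CStarRing.norm_star_mul_self, hp.isSelfAdjoint.star_eq, hp.isIdempotentElem.eq]
  nlinarith [norm_nonneg p]

/-! ### Norm estimates for the unitary `1 + b⋆(a - b)` -/

lemma norm_unitary_sub_one_mul_le (h : IsBalanced a b) (hd : IsProjDecomposition a b ε p) :
    ‖(1 + star b * (a - b) - 1) * (1 - p)‖ ≤ 2 * ε := by
  have h1 : (1 + star b * (a - b) - 1) * (1 - p) =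
      star b * (p * (a - b) * (1 - p) + (1 - p) * (a - b) * (1 - p)) := by noncomm_ring
  rw [h1, ← one_mul (2 * ε)]
  refine norm_mul_le_of_le (by rw [norm_star]; exact h.norm_right) ?_
  linarith [norm_add_le (p * (a - b) * (1 - p)) ((1 - p) * (a - b) * (1 - p)), hd.close₁₂,
    hd.close₂₂]

/-- A unitary close to the identity on the range of `1 - p` almost preserves the range of `p`. -/
lemma norm_compl_mul_unitary_mul_le (hp : IsStarProjection p) {z : Q} {r : ℝ}
    (hz : star z * z = 1) (hz1 : ‖z‖ ≤ 1) (hr : ‖(z - 1) * (1 - p)‖ ≤ r) :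
    ‖(1 - p) * z * p‖ ≤ r := by
  have hps := hp.isSelfAdjoint.star_eq
  have hpi := hp.isIdempotentElem.eq
  have h1 : (1 - p) * z * p = (1 - p) * (z - 1) * p := by
    simp only [mul_sub, sub_mul, mul_assoc, mul_one, one_mul, hpi]; abel
  have h2 : star ((1 - p) * (z - 1)) = -(star z * ((z - 1) * (1 - p))) := by
    have h3 : star z * (z - 1) = 1 - star z := by rw [mul_sub, hz, mul_one]
    rw [star_mul, star_sub, star_sub, star_one, hps, ← mul_assoc, h3]
    noncomm_ring
  rw [h1, ← mul_one r]
  refine norm_mul_le_of_le ?_ (norm_le_one_of_isStarProjection hp)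
  rw [← norm_star, h2, norm_neg, ← one_mul r]
  exact norm_mul_le_of_le (by rwa [norm_star]) hr

lemma norm_one_le : ‖(1 : Q)‖ ≤ 1 :=
  norm_le_one_of_isStarProjection (.one Q)

lemma norm_le_one_of_star_mul_self {z : Q} (hz : star z * z = 1) : ‖z‖ ≤ 1 := by
  have h := CStarRing.norm_star_mul_self (x := z)
  rw [hz] at h
  nlinarith [norm_nonneg z, norm_one_le (Q := Q)]

/-- The unitary `1 + b⋆(a - b)` is close to the direct sum of its `p`-corner and the identity. -/
lemma norm_star_unitary_mul_corner_sub_one_lt (h : IsBalanced a b) (hp : IsStarProjection p)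
    (hd : IsProjDecomposition a b ε p) (hε : ε < 1 / 20) :
    ‖star (1 + star b * (a - b)) * (p * (1 + star b * (a - b)) * p + (1 - p)) - 1‖ < 1 := by
  have hz := h.star_mul_unitary
  have h1 := norm_unitary_sub_one_mul_le h hd
  set z := 1 + star b * (a - b)
  have hz1 := norm_le_one_of_star_mul_self hz
  have h2 := norm_compl_mul_unitary_mul_le hp hz hz1 h1
  have h3 : star z * (p * z * p + (1 - p)) - 1 =
      -(star z * ((1 - p) * z * p + (z - 1) * (1 - p))) := by
    have : p * z * p + (1 - p) = z - ((1 - p) * z * p + (z - 1) * (1 - p)) := by noncomm_ring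
    rw [this, mul_sub, hz]; abel
  rw [h3, norm_neg]
  refine (norm_mul_le_of_le ((norm_star _).trans_le hz1) (norm_add_le_of_le h2 h1)).trans_lt ?_
  linarith

/-! ### Approximate parametrices of the compressed operators -/

section Parametrix

variable {x c : Q}

/-- The operator `c⋆x + (1 - x⋆x)`, where `x` and `c` stand for the `(1,1)` entries of one of the
two operators and of an auxiliary operator, is close to `c⋆x + c₂⋆x₂`, but the estimates
for it involve no second components. -/
def parametrix (x c : Q) : Q := star c * x + (1 - star x * x)

/-- Replacing `cc⋆` by `xx⋆`, and `c` by `x` next to `1 - x⋆x`, turns the product `w⋆w` for the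
parametrix `w` into `(x⋆x + (1 - x⋆x)) ^ 2 = 1`. -/
lemma norm_star_parametrix_mul_sub_one_le (hx : ‖x‖ ≤ 1)
    (h₁ : ‖c * star c - x * star x‖ ≤ 2 * ε)
    (h₂ : ‖(c - x) * (1 - star x * x)‖ ≤ 4 * ε) :
    ‖star (parametrix x c) * parametrix x c - 1‖ ≤ 10 * ε := by
  have hx' : ‖star x‖ ≤ 1 := by rwa [norm_star]
  have h₂' : ‖star ((c - x) * (1 - star x * x))‖ ≤ 4 * ε := by rwa [norm_star]
  have key : star (parametrix x c) * parametrix x c - 1 =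
      star x * (c * star c - x * star x) * x + star x * ((c - x) * (1 - star x * x))
        + star ((c - x) * (1 - star x * x)) * x := by
    simp only [parametrix, star_add, star_mul, star_star, star_sub, star_one]
    noncomm_ring
  rw [key]
  have e₁ := norm_mul_mul_le hx' h₁ hx
  have e₂ := norm_mul_le_of_le hx' h₂
  have e₃ := norm_mul_le_of_le h₂' hx
  linarith [norm_add₃_le (a := star x * (c * star c - x * star x) * x)
    (b := star x * ((c - x) * (1 - star x * x))) (c := star ((c - x) * (1 - star x * x)) * x)]

lemma norm_parametrix_mul_star_sub_one_lt (hx : ‖x‖ ≤ 1) (hε : ε < 1 / 20)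
    (h₀ : ‖star c * c - star x * x‖ ≤ 2 * ε)
    (h₁ : ‖c * star c - x * star x‖ ≤ 2 * ε)
    (h₂ : ‖(c - x) * (1 - star x * x)‖ ≤ 4 * ε) :
    ‖parametrix x c * star (parametrix x c) - 1‖ < 1 := by
  have hε0 : 0 ≤ ε := by linarith [norm_nonneg (star c * c - star x * x)]
  -- `‖c‖ ^ 2 ≤ 1 + 2ε`
  have hc : ‖c‖ ≤ 21 / 20 := by
    have hcc : ‖c‖ * ‖c‖ ≤ 11 / 10 := by
      rw [← CStarRing.norm_star_mul_self]
      have : ‖star x * x‖ ≤ 1 * 1 := norm_mul_le_of_le (by rwa [norm_star]) hx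
      linarith [norm_le_norm_sub_add (star c * c) (star x * x)]
    nlinarith [norm_nonneg c]
  have hc' : ‖star c‖ ≤ 21 / 20 := by rwa [norm_star]
  have h₂' : ‖star ((c - x) * (1 - star x * x))‖ ≤ 4 * ε := by rwa [norm_star]
  set g := star c * c - star x * x with hg
  -- the main term is `(c⋆c + (1 - x⋆x)) ^ 2 = (1 + g) ^ 2`
  have key : parametrix x c * star (parametrix x c) - 1 =
      -(star c * (c * star c - x * star x) * c) - star c * ((c - x) * (1 - star x * x))
        - star ((c - x) * (1 - star x * x)) * c + g * g + g + g := by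
    simp only [parametrix, star_add, star_mul, star_star, star_sub, star_one, hg]
    noncomm_ring
  rw [key]
  have e₁ := norm_mul_le_of_le (norm_mul_le_of_le hc' h₁) hc
  have e₂ := norm_mul_le_of_le hc' h₂
  have e₃ := norm_mul_le_of_le h₂' hc
  have e₄ := norm_mul_le_of_le h₀ h₀
  have e := norm_add_le_of_le (norm_add_le_of_le (norm_add_le_of_le (norm_sub_le_of_le
    (norm_sub_le_of_le ((norm_neg _).trans_le e₁) e₂) e₃) e₄) h₀) h₀
  -- the six terms add up to less than `15ε`
  refine e.trans_lt ?_
  nlinarith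

end Parametrix

/-- The conditions on the first column `c` of an auxiliary operator that enter the estimates. -/
structure IsProjAdmissible (ε : ℝ) (p a c : Q) : Prop where
  snd_close : ‖(1 - p) * c - (1 - p) * a * p‖ < ε
  star_mul_close : ‖star (p * c) * (p * c) - star (p * a * p) * (p * a * p)‖ < 2 * ε
  mul_star_close : ‖p * c * star (p * c) - p * a * p * star (p * a * p)‖ < 2 * ε
  defect_close : ‖(p * c - p * a * p) * (1 - star (p * a * p) * (p * a * p))‖ < 4 * ε

section Column

variable {c : Q}

lemma norm_parametrix_le (ha : ‖a‖ ≤ 1) (hp : IsStarProjection p) (hε : ε < 1 / 20)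
    (hc : IsProjAdmissible ε p a c) : ‖parametrix (p * a * p) (p * c)‖ ≤ 5 / 4 := by
  have hp1 := norm_le_one_of_isStarProjection hp
  have h := norm_star_parametrix_mul_sub_one_le (norm_mul_mul_le hp1 ha hp1)
    hc.mul_star_close.le hc.defect_close.le
  set w := parametrix (p * a * p) (p * c)
  have hw : ‖w‖ * ‖w‖ ≤ 3 / 2 := by
    rw [← CStarRing.norm_star_mul_self]
    linarith [norm_le_norm_sub_add (star w * w) 1, norm_one_le (Q := Q)]
  nlinarith [norm_nonneg w]

/-- The compressed operator `c⋆a`, extended by the identity, is close to the parametrix. -/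
lemma norm_compressed_sub_parametrix_le (ha : ‖a‖ ≤ 1) (hp : IsStarProjection p)
    (hd : ‖p * (1 - star a * a) * p‖ < ε) (hc : IsProjAdmissible ε p a c) :
    ‖star c * a * p + (1 - p) - parametrix (p * a * p) (p * c)‖ ≤ 2 * ε := by
  have hps := hp.isSelfAdjoint.star_eq
  have hpi := hp.isIdempotentElem.eq
  have hpi' : ∀ y, p * (p * y) = p * y := fun y => by rw [← mul_assoc, hpi]
  have key : star c * a * p + (1 - p) - parametrix (p * a * p) (p * c) =
      star ((1 - p) * c - (1 - p) * a * p) * ((1 - p) * a * p)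
        - p * (1 - star a * a) * p := by
    simp only [parametrix, star_sub, star_mul, hps, mul_sub, sub_mul, mul_assoc, mul_one,
      one_mul, hpi, hpi']
    abel
  have h2 : ‖(1 - p) * a * p‖ ≤ 1 := norm_mul_mul_le
    (norm_le_one_of_isStarProjection hp.one_sub) ha (norm_le_one_of_isStarProjection hp)
  rw [key]
  refine (norm_sub_le_of_le (norm_mul_le_of_le ((norm_star _).trans_le hc.snd_close.le) h2)
    hd.le).trans ?_
  linarith

lemma norm_star_parametrix_mul_compressed_sub_one_le (ha : ‖a‖ ≤ 1) (hp : IsStarProjection p)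
    (hd : ‖p * (1 - star a * a) * p‖ < ε) (hε : ε < 1 / 20) (hc : IsProjAdmissible ε p a c) :
    ‖star (parametrix (p * a * p) (p * c)) * (star c * a * p + (1 - p)) - 1‖ ≤ 25 / 2 * ε := by
  have hp1 := norm_le_one_of_isStarProjection hp
  have h := norm_star_parametrix_mul_sub_one_le (norm_mul_mul_le hp1 ha hp1)
    hc.mul_star_close.le hc.defect_close.le
  have h1 := norm_parametrix_le ha hp hε hc
  have h2 := norm_compressed_sub_parametrix_le ha hp hd hc
  set w := parametrix (p * a * p) (p * c)
  set v := star c * a * p + (1 - p)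
  have key : star w * v - 1 = star w * (v - w) + (star w * w - 1) := by noncomm_ring
  rw [key]
  refine (norm_add_le_of_le (norm_mul_le_of_le ((norm_star _).trans_le h1) h2) h).trans ?_
  linarith

lemma norm_column_le (ha : ‖a‖ ≤ 1) (hp : IsStarProjection p) (hε : ε < 1 / 20)
    (hc : IsProjAdmissible ε p a c) : ‖c‖ ≤ 21 / 10 := by
  have hp1 := norm_le_one_of_isStarProjection hp
  have hx := norm_mul_mul_le hp1 ha hp1
  have h1 : ‖p * c‖ ≤ 21 / 20 := by
    have hcc : ‖p * c‖ * ‖p * c‖ ≤ 11 / 10 := by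
      rw [← CStarRing.norm_star_mul_self]
      have := norm_mul_le_of_le ((norm_star (p * a * p)).trans_le hx) hx
      linarith [norm_le_norm_sub_add (star (p * c) * (p * c)) (star (p * a * p) * (p * a * p)),
        hc.star_mul_close]
    nlinarith [norm_nonneg (p * c)]
  have h2 : ‖(1 - p) * c‖ ≤ 21 / 20 := by
    have := norm_mul_mul_le (norm_le_one_of_isStarProjection hp.one_sub) ha hp1
    linarith [norm_le_norm_sub_add ((1 - p) * c) ((1 - p) * a * p), hc.snd_close]
  have h3 : c = p * c + (1 - p) * c := by noncomm_ring
  rw [h3]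
  linarith [norm_add_le (p * c) ((1 - p) * c)]

/-- Since `b(1 + b⋆(a - b)) = a`, composing `c⋆b` with the corner of the unitary `1 + b⋆(a - b)`
gives `c⋆a` up to a small error. -/
lemma norm_star_parametrix_mul_compressed_mul_corner_sub_one_lt (h : IsBalanced a b)
    (hp : IsStarProjection p) (hd : IsProjDecomposition a b ε p) (hε : ε < 1 / 20)
    (hc : IsProjAdmissible ε p a c) :
    ‖star (parametrix (p * a * p) (p * c)) * ((star c * b * p + (1 - p)) *
      (p * (1 + star b * (a - b)) * p + (1 - p))) - 1‖ < 1 := by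
  have hpi := hp.isIdempotentElem.eq
  have hpi' : ∀ y, p * (p * y) = p * y := fun y => by rw [← mul_assoc, hpi]
  have hz := h.star_mul_unitary
  have hbz := h.mul_unitary
  have h1 := norm_unitary_sub_one_mul_le h hd
  set z := 1 + star b * (a - b)
  have h2 := norm_compl_mul_unitary_mul_le hp hz (norm_le_one_of_star_mul_self hz) h1
  have h3 := norm_star_parametrix_mul_compressed_sub_one_le h.norm_left hp hd.defect₁₁ hε hc
  have h4 := norm_column_le h.norm_left hp hε hc
  have h5 := norm_parametrix_le h.norm_left hp hε hc
  set w := parametrix (p * a * p) (p * c)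
  have h6 : (star c * b * p + (1 - p)) * (p * z * p + (1 - p)) =
      star c * a * p + (1 - p) - star c * b * ((1 - p) * z * p) := by
    rw [← hbz]
    simp only [mul_sub, sub_mul, mul_add, add_mul, mul_assoc, mul_one, one_mul, hpi, hpi']
    abel
  have key : star w * ((star c * b * p + (1 - p)) * (p * z * p + (1 - p))) - 1 =
      (star w * (star c * a * p + (1 - p)) - 1)
        - star w * (star c * b * ((1 - p) * z * p)) := by
    rw [h6]; noncomm_ring
  -- the two terms add up to at most `(25 / 2 + 21 / 4)ε < 20ε`
  rw [key]
  refine (norm_sub_le_of_le h3 (norm_mul_le_of_le ((norm_star _).trans_le h5)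
    (norm_mul_le_of_le (norm_mul_le_of_le ((norm_star _).trans_le h4) h.norm_right) h2))).trans_lt
    ?_
  linarith

end Column

/-! ### The two operators are auxiliary operators -/

/-- Since `a⋆a = b⋆b`, the difference on the corners is the opposite of the difference on the second
components, which are close. -/
lemma norm_star_corner_mul_corner_sub_lt (h : IsBalanced a b) (hp : IsStarProjection p)
    (hd : IsProjDecomposition a b ε p) :
    ‖star (p * b * p) * (p * b * p) - star (p * a * p) * (p * a * p)‖ < 2 * ε := by
  have hps := hp.isSelfAdjoint.star_eq
  have hpi := hp.isIdempotentElem.eq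
  have hpi' : ∀ y, p * (p * y) = p * y := fun y => by rw [← mul_assoc, hpi]
  have hs' : ∀ y, star a * (a * y) = star b * (b * y) := fun y => by
    rw [← mul_assoc, h.star_mul_self, mul_assoc]
  have hp1 := norm_le_one_of_isStarProjection hp
  have hq1 := norm_le_one_of_isStarProjection hp.one_sub
  have key : star (p * b * p) * (p * b * p) - star (p * a * p) * (p * a * p) =
      star ((1 - p) * a * p) * ((1 - p) * (a - b) * p)
        + star ((1 - p) * (a - b) * p) * ((1 - p) * b * p) := by
    simp only [star_sub, star_mul, hps, mul_sub, sub_mul, mul_assoc, one_mul, hpi', hs']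
    abel
  have e₁ := norm_mul_le_of_le ((norm_star _).trans_le (norm_mul_mul_le hq1 h.norm_left hp1))
    (le_refl ‖(1 - p) * (a - b) * p‖)
  have e₂ := norm_mul_le_of_le (norm_star ((1 - p) * (a - b) * p)).le
    (norm_mul_mul_le hq1 h.norm_right hp1)
  rw [key]
  refine (norm_add_le_of_le e₁ e₂).trans_lt ?_
  linarith [hd.close₂₁]

/-- Writing `x₁ = pxp` and `x₂ = (1 - p)xp`, the defect `1 - a₁⋆a₁` of the corner is the corner of
`1 - a⋆a`, which is almost annihilated by `b₁ - a₁`, plus `a₂⋆a₂`; and `(b₁ - a₁)a₂⋆` is small since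
`aa⋆ = bb⋆` expresses it through entries at which `a` and `b` are close. -/
lemma norm_corner_sub_mul_defect_lt (h : IsBalanced a b) (hp : IsStarProjection p)
    (hd : IsProjDecomposition a b ε p) (hε : ε < 1 / 20) :
    ‖(p * b * p - p * a * p) * (1 - star (p * a * p) * (p * a * p))‖ < 4 * ε := by
  have hps := hp.isSelfAdjoint.star_eq
  have hpi := hp.isIdempotentElem.eq
  have hpi' : ∀ y, p * (p * y) = p * y := fun y => by rw [← mul_assoc, hpi]
  have hp1 := norm_le_one_of_isStarProjection hp
  have hq1 := norm_le_one_of_isStarProjection hp.one_sub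
  have hbd : (b - a) * (1 - star a * a) = 0 := by
    rw [sub_mul, h.mul_defect, h.star_mul_self, sub_self]
  -- the defect of the corner is the corner of the defect plus `x₂⋆x₂`
  have k₁ : (p * b * p - p * a * p) * (1 - star (p * a * p) * (p * a * p)) =
      (p * b * p - p * a * p) * (p * (1 - star a * a) * p)
        + (p * b * p - p * a * p) * (p * star a * (1 - p)) * ((1 - p) * a * p) := by
    simp only [star_mul, hps, mul_sub, sub_mul, mul_assoc, mul_one, one_mul, hpi, hpi']
    abel
  have k₂ : (p * b * p - p * a * p) * (p * (1 - star a * a) * p) =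
      p * (a - b) * (1 - p) * ((1 - p) * (1 - star a * a) * p) := by
    have e : p * ((b - a) * (1 - star a * a)) * p = 0 := by rw [hbd, mul_zero, zero_mul]
    rw [← sub_eq_zero, ← e]
    simp only [mul_sub, sub_mul, mul_assoc, mul_one, one_mul, hpi, hpi']
    abel
  have k₃ : (p * b * p - p * a * p) * (p * star a * (1 - p)) =
      p * (a - b) * (1 - p) * star ((1 - p) * a * (1 - p))
        + p * b * (1 - p) * star ((1 - p) * (a - b) * (1 - p))
        + p * b * p * star ((1 - p) * (a - b) * p) := by
    have e : p * (b * star b - a * star a) * (1 - p) = 0 := by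
      rw [h.mul_star_self, sub_self, mul_zero, zero_mul]
    rw [← sub_eq_zero, ← e]
    simp only [star_sub, star_mul, hps, mul_sub, sub_mul, mul_assoc, mul_one, one_mul, hpi']
    abel
  rw [k₁, k₂, k₃]
  have e₂ := norm_mul_le_of_le (le_refl ‖p * (a - b) * (1 - p)‖)
    (hd.defect₂₁.le.trans (show ε ≤ 1 by linarith))
  have e₃ := norm_mul_le_of_le (norm_add_le_of_le (norm_add_le_of_le
    (norm_mul_le_of_le (le_refl ‖p * (a - b) * (1 - p)‖)
      ((norm_star _).trans_le (norm_mul_mul_le hq1 h.norm_left hq1)))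
    (norm_mul_le_of_le (norm_mul_mul_le hp1 h.norm_right hq1)
      (norm_star ((1 - p) * (a - b) * (1 - p))).le))
    (norm_mul_le_of_le (norm_mul_mul_le hp1 h.norm_right hp1)
      (norm_star ((1 - p) * (a - b) * p)).le))
    (norm_mul_mul_le hq1 h.norm_left hp1)
  refine (norm_add_le_of_le e₂ e₃).trans_lt ?_
  linarith [hd.close₁₂, hd.close₂₁, hd.close₂₂]

end CStar

/-! ### Operators on a subspace as corners of operators on the whole space -/

section Corner

variable {H : Type*} [NormedAddCommGroup H] [InnerProductSpace ℂ H]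

/-- Extending an operator `W → V` by zero to the whole space preserves the essential norm. -/
lemma norm_dot_subtypeL_comp {V W : Submodule ℂ H} [W.HasOrthogonalProjection]
    [V.HasOrthogonalProjection] (Y : W →L[ℂ] V) :
    ‖dot (V.subtypeL ∘L Y ∘L W.orthogonalProjectionOnto)‖ = ‖dot Y‖ := by
  have hV := V.norm_subtypeL_le
  have hW := W.norm_subtypeL_le
  have hV' := V.orthogonalProjectionOnto_norm_le
  have hW' := W.orthogonalProjectionOnto_norm_le
  apply le_antisymm
  · calc _ ≤ ‖V.subtypeL‖ * ‖dot (Y ∘L W.orthogonalProjectionOnto)‖ := norm_dot_comp_le _ _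
      _ ≤ 1 * (‖dot Y‖ * 1) := by
          gcongr
          exact (norm_dot_comp_le' _ _).trans (by gcongr)
      _ = ‖dot Y‖ := by ring
  · have h : Y = V.orthogonalProjectionOnto ∘L
        ((V.subtypeL ∘L Y ∘L W.orthogonalProjectionOnto) ∘L W.subtypeL) := by
      ext x; simp
    calc ‖dot Y‖ = ‖dot (V.orthogonalProjectionOnto ∘L
          ((V.subtypeL ∘L Y ∘L W.orthogonalProjectionOnto) ∘L W.subtypeL))‖ := by rw [← h]
      _ ≤ ‖V.orthogonalProjectionOnto‖ *
          ‖dot ((V.subtypeL ∘L Y ∘L W.orthogonalProjectionOnto) ∘L W.subtypeL)‖ :=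
          norm_dot_comp_le _ _
      _ ≤ 1 * (‖dot (V.subtypeL ∘L Y ∘L W.orthogonalProjectionOnto)‖ * 1) := by
          gcongr
          exact (norm_dot_comp_le' _ _).trans (by gcongr)
      _ = _ := by ring

lemma norm_dot_starProjection_mul_mul {V W : Submodule ℂ H} [W.HasOrthogonalProjection]
    [V.HasOrthogonalProjection] (T : H →L[ℂ] H) :
    ‖dot (V.starProjection * T * W.starProjection)‖ = ‖dot (block V W T)‖ :=
  norm_dot_subtypeL_comp (block V W T)

variable (U : Submodule ℂ H) [CompleteSpace U]

/-- The extension by zero of an operator on `U`, an injective ring homomorphism without unit. -/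
def extend (Y : U →L[ℂ] U) : H →L[ℂ] H := U.subtypeL ∘L Y ∘L U.orthogonalProjectionOnto

/-- The extension by zero `H → H` of an operator `U → H`, i.e. its composition with the
projection onto `U`. -/
def column (C : U →L[ℂ] H) : H →L[ℂ] H := C ∘L U.orthogonalProjectionOnto

variable {U}

lemma norm_dot_extend (Y : U →L[ℂ] U) : ‖dot (extend U Y)‖ = ‖dot Y‖ := norm_dot_subtypeL_comp Y

lemma extend_sub (Y Z : U →L[ℂ] U) : extend U (Y - Z) = extend U Y - extend U Z := by
  ext x; simp [extend]

lemma extend_mul (Y Z : U →L[ℂ] U) : extend U (Y * Z) = extend U Y * extend U Z := by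
  ext x; simp [extend]

lemma extend_mul_one_sub (Y Z : U →L[ℂ] U) :
    extend U (Y * (1 - Z)) = extend U Y * (1 - extend U Z) := by
  rw [extend_mul, extend_sub, mul_sub, mul_sub, ← extend_mul, ← extend_mul, mul_one, mul_one]

lemma extend_fstComp (C : U →L[ℂ] H) :
    extend U (fstComp U C) = U.starProjection * column U C := rfl

lemma extend_fstComp_restr (X : H →L[ℂ] H) :
    extend U (fstComp U (restr U X)) = U.starProjection * X * U.starProjection := rfl

lemma dot_starProjection_orthogonal : dot Uᗮ.starProjection = 1 - dot U.starProjection := by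
  rw [Submodule.starProjection_orthogonal', dot_sub, dot_one]

lemma isAdmissibleFor_self {ε : ℝ} {Y : U →L[ℂ] H} (hε : 0 < ε) : IsAdmissibleFor ε U Y Y := by
  have h0 : ‖dot (0 : U →L[ℂ] U)‖ = 0 :=
    le_antisymm ((norm_dot_le (0 : U →L[ℂ] U)).trans_eq ContinuousLinearMap.opNorm_zero)
      (norm_nonneg (dot (0 : U →L[ℂ] U)))
  constructor
  · rw [sub_self, ContinuousLinearMap.opNorm_zero]; exact hε
  · rw [sub_self, h0]; linarith
  · rw [sub_self, h0]; linarith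
  · rw [sub_self, zero_mul, h0]; linarith
  · have hs : star (0 : U →L[ℂ] U) = 0 :=
      map_zero (ContinuousLinearMap.adjoint (𝕜 := ℂ) (E := U) (F := U))
    rw [sub_self, hs, zero_mul, h0]; linarith

variable [CompleteSpace H]

lemma extend_star (Y : U →L[ℂ] U) : extend U (star Y) = star (extend U Y) := by
  simp only [extend, ContinuousLinearMap.star_eq_adjoint, ContinuousLinearMap.adjoint_comp,
    Submodule.adjoint_subtypeL, Submodule.adjoint_orthogonalProjectionOnto]
  rfl

lemma isStarProjection_dot_starProjection : IsStarProjection (dot U.starProjection) where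
  isIdempotentElem := congrArg dot U.isIdempotentElem_starProjection.eq
  isSelfAdjoint := congrArg dot (isSelfAdjoint_starProjection U).star_eq

variable {A B X : H →L[ℂ] H} {ε : ℝ} {C : U →L[ℂ] H}

lemma IsKBalanced.isBalanced (h : IsKBalanced A B) : IsBalanced (dot A) (dot B) :=
  ⟨h.1, h.2, h.3, h.4, h.5, h.6⟩

lemma IsDecomposition.isProjDecomposition (hd : IsDecomposition A B ε U) :
    IsProjDecomposition (dot A) (dot B) ε (dot U.starProjection) := by
  have hsub : ∀ (V W : Submodule ℂ H) [V.HasOrthogonalProjection], block V W (A - B) =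
      block V W A - block V W B := fun V W _ => by ext x; simp [block]
  have hS := (hd.defect (1 - star A * A) (by simp))
  have hS' := (hd.defect (1 - A * star A) (by simp))
  constructor
  · rw [← dot_starProjection_orthogonal, ← dot_sub, ← dot_mul, ← dot_mul,
      norm_dot_starProjection_mul_mul, hsub]
    exact (norm_dot_le _).trans_lt hd.close₁₂
  · rw [← dot_starProjection_orthogonal, ← dot_sub, ← dot_mul, ← dot_mul,
      norm_dot_starProjection_mul_mul, hsub]
    exact (norm_dot_le _).trans_lt hd.close₂₁
  · rw [← dot_starProjection_orthogonal, ← dot_sub, ← dot_mul, ← dot_mul,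
      norm_dot_starProjection_mul_mul, hsub]
    exact (norm_dot_le _).trans_lt hd.close₂₂
  · exact (norm_dot_starProjection_mul_mul (V := U) (W := U) _).trans_lt (norm_dot_lt_iff.2 hS.1)
  · rw [← dot_starProjection_orthogonal]
    exact (norm_dot_starProjection_mul_mul (V := Uᗮ) (W := U) _).trans_lt
      (norm_dot_lt_iff.2 hS.2.2)
  · exact (norm_dot_starProjection_mul_mul (V := U) (W := U) _).trans_lt (norm_dot_lt_iff.2 hS'.1)
  · rw [← dot_starProjection_orthogonal]
    exact (norm_dot_starProjection_mul_mul (V := Uᗮ) (W := U) _).trans_lt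
      (norm_dot_lt_iff.2 hS'.2.2)

lemma IsAdmissibleFor.isProjAdmissible (h : IsAdmissibleFor ε U (restr U X) C) :
    IsProjAdmissible ε (dot U.starProjection) (dot X) (dot (column U C)) where
  snd_close := by
    rw [← dot_starProjection_orthogonal]
    have e : Uᗮ.starProjection * column U C - Uᗮ.starProjection * X * U.starProjection =
        Uᗮ.subtypeL ∘L (sndComp U C - sndComp U (restr U X)) ∘L U.orthogonalProjectionOnto := by
      ext x; simp [column, sndComp, restr]
    calc _ = ‖dot (Uᗮ.starProjection * column U C - Uᗮ.starProjection * X * U.starProjection)‖ :=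
          rfl
      _ = ‖dot (sndComp U C - sndComp U (restr U X))‖ := by rw [e, norm_dot_subtypeL_comp]
      _ < ε := (norm_dot_le _).trans_lt h.snd_close
  star_mul_close := by
    have := h.star_mul_close
    rwa [← norm_dot_extend, extend_sub, extend_mul, extend_mul, extend_star, extend_star,
      extend_fstComp, extend_fstComp_restr] at this
  mul_star_close := by
    have := h.mul_star_close
    rwa [← norm_dot_extend, extend_sub, extend_mul, extend_mul, extend_star, extend_star,
      extend_fstComp, extend_fstComp_restr] at this
  defect_close := by
    have := h.defect_close
    rwa [← norm_dot_extend, extend_mul_one_sub, extend_sub, extend_mul, extend_star,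
      extend_fstComp, extend_fstComp_restr] at this

/-- Each operator of a balanced pair satisfies the conditions with respect to the other one. The
estimates for adjoints are those for the balanced pair of the adjoints. -/
lemma isAdmissibleFor_restr (h : IsKBalanced A B) (hε : ε < 1 / 20)
    (hd : IsDecomposition A B ε U) : IsAdmissibleFor ε U (restr U A) (restr U B) := by
  have hb := h.isBalanced
  have hp := isStarProjection_dot_starProjection (U := U)
  have hps := hp.isSelfAdjoint.star_eq
  have hD := hd.isProjDecomposition
  have k₁ := norm_star_corner_mul_corner_sub_lt hb.conj hp (hD.conj hp)
  have k₂ := norm_corner_sub_mul_defect_lt hb.conj hp (hD.conj hp) hε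
  constructor
  · exact (norm_sub_rev (block Uᗮ U B) (block Uᗮ U A)).trans_lt hd.close₂₁
  · rw [← norm_dot_extend, extend_sub, extend_mul, extend_mul, extend_star, extend_star,
      extend_fstComp_restr, extend_fstComp_restr]
    simpa only [dot_sub, dot_mul, dot_star] using norm_star_corner_mul_corner_sub_lt hb hp hD
  · rw [← norm_dot_extend, extend_sub, extend_mul, extend_mul, extend_star, extend_star,
      extend_fstComp_restr, extend_fstComp_restr]
    simpa only [star_sub, star_mul, star_star, hps, ← mul_assoc, dot_sub, dot_mul, dot_star]
      using k₁
  · rw [← norm_dot_extend, extend_mul_one_sub, extend_sub, extend_mul, extend_star,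
      extend_fstComp_restr, extend_fstComp_restr]
    simpa only [dot_sub, dot_mul, dot_star, dot_one] using
      norm_corner_sub_mul_defect_lt hb hp hD hε
  · rw [← norm_dot_extend, extend_mul_one_sub, extend_star, extend_sub, extend_mul, extend_star,
      extend_fstComp_restr, extend_fstComp_restr]
    simpa only [star_sub, star_mul, star_star, hps, ← mul_assoc, dot_sub, dot_mul, dot_star,
      dot_one] using k₂

lemma IsKBalanced.symm (h : IsKBalanced A B) : IsKBalanced B A :=
  ⟨h.2, h.1, h.3.symm, h.4.symm, h.5.symm, h.6.symm⟩

lemma IsDecomposition.symm (hd : IsDecomposition A B ε U) : IsDecomposition B A ε U where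
  close₁₂ := (norm_sub_rev (block U Uᗮ B) (block U Uᗮ A)).trans_lt hd.close₁₂
  close₂₁ := (norm_sub_rev (block Uᗮ U B) (block Uᗮ U A)).trans_lt hd.close₂₁
  close₂₂ := (norm_sub_rev (block Uᗮ Uᗮ B) (block Uᗮ Uᗮ A)).trans_lt hd.close₂₂
  defect := fun T hT => hd.defect T (by
    simp only [Set.mem_insert_iff, Set.mem_singleton_iff] at hT ⊢
    tauto)

/-! ### The relative index -/

/-- The compressed operator `C⋆A`, extended by the identity to the whole space. -/
def extendedCompressed (U : Submodule ℂ H) [CompleteSpace U] (C : U →L[ℂ] H) (A : H →L[ℂ] H) :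
    H →L[ℂ] H :=
  star (column U C) * A * U.starProjection + (1 - U.starProjection)

lemma extendedCompressed_eq : extendedCompressed U C A =
    U.subtypeL ∘L compressed U C A ∘L U.orthogonalProjectionOnto + (1 - U.starProjection) := by
  rw [extendedCompressed, column, ContinuousLinearMap.star_eq_adjoint,
    ContinuousLinearMap.adjoint_comp, Submodule.adjoint_orthogonalProjectionOnto]
  rfl

/-- The adjoint of the parametrix is Fredholm and inverts the compressed operator approximately. -/
lemma isFredholm_star_parametrix (hA : ‖dot A‖ ≤ 1) (hε : ε < 1 / 20)
    (hC : IsAdmissibleFor ε U (restr U A) C) :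
    (star (parametrix (U.starProjection * A * U.starProjection)
      (U.starProjection * column U C))).IsFredholm := by
  have hp := isStarProjection_dot_starProjection (U := U)
  have hp1 := norm_le_one_of_isStarProjection hp
  have hc := hC.isProjAdmissible
  have hε0 : 0 < ε :=
    lt_of_le_of_lt (norm_nonneg (sndComp U C - sndComp U (restr U A))) hC.snd_close
  have hx := norm_mul_mul_le hp1 hA hp1
  refine isFredholm_of_norm_lt_one (R := parametrix (U.starProjection * A * U.starProjection)
      (U.starProjection * column U C)) ?_ ?_
  · simpa only [parametrix, dot_star, dot_add, dot_mul, dot_sub, dot_one] using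
      norm_parametrix_mul_star_sub_one_lt hx hε hc.star_mul_close.le hc.mul_star_close.le
        hc.defect_close.le
  · have h := (norm_star_parametrix_mul_sub_one_le hx hc.mul_star_close.le
      hc.defect_close.le).trans_lt (show 10 * ε < 1 by linarith)
    simpa only [parametrix, dot_star, dot_add, dot_mul, dot_sub, dot_one] using h

lemma isFredholm_extendedCompressed (hA : ‖dot A‖ ≤ 1) (hε : ε < 1 / 20)
    (hd : IsDecomposition A B ε U) (hC : IsAdmissibleFor ε U (restr U A) C) :
    (extendedCompressed U C A).IsFredholm ∧ ind (extendedCompressed U C A) =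
      -ind (star (parametrix (U.starProjection * A * U.starProjection)
        (U.starProjection * column U C))) := by
  have hε0 : 0 < ε :=
    lt_of_le_of_lt (norm_nonneg (sndComp U C - sndComp U (restr U A))) hC.snd_close
  have h := (norm_star_parametrix_mul_compressed_sub_one_le hA isStarProjection_dot_starProjection
    hd.isProjDecomposition.defect₁₁ hε hC.isProjAdmissible).trans_lt
    (show 25 / 2 * ε < 1 by linarith)
  refine isFredholm_and_ind_eq_neg (isFredholm_star_parametrix hA hε hC) ?_
  simpa only [extendedCompressed, parametrix, dot_star, dot_add, dot_mul, dot_sub, dot_one] using h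

/-- An operator that is unitary modulo compact operators is Fredholm. -/
lemma isFredholm_of_dot_unitary {T : H →L[ℂ] H} (h₁ : star (dot T) * dot T = 1)
    (h₂ : dot T * star (dot T) = 1) : T.IsFredholm := by
  refine isFredholm_of_norm_lt_one (R := star T) ?_ ?_
  · rw [dot_star, h₁, sub_self, norm_zero]
    exact one_pos
  · rw [dot_star, h₂, sub_self, norm_zero]
    exact one_pos

lemma dot_one_add_star_mul_sub :
    dot (1 + star B * (A - B)) = 1 + star (dot B) * (dot A - dot B) := rfl

lemma isFredholm_unitary (h : IsKBalanced A B) : (1 + star B * (A - B)).IsFredholm :=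
  isFredholm_of_dot_unitary h.isBalanced.star_mul_unitary h.isBalanced.unitary_mul_star

/-- The corner of `1 + B⋆(A - B)` is Fredholm with the same index. -/
lemma isFredholm_corner_unitary (h : IsKBalanced A B) (hε : ε < 1 / 20)
    (hd : IsDecomposition A B ε U) :
    (U.starProjection * (1 + star B * (A - B)) * U.starProjection +
      (1 - U.starProjection)).IsFredholm ∧
    ind (U.starProjection * (1 + star B * (A - B)) * U.starProjection + (1 - U.starProjection)) =
      ind (1 + star B * (A - B)) := by
  have hb := h.isBalanced
  have h₁ : star (dot (1 + star B * (A - B))) * dot (1 + star B * (A - B)) = 1 :=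
    hb.star_mul_unitary
  have h₂ : dot (1 + star B * (A - B)) * star (dot (1 + star B * (A - B))) = 1 :=
    hb.unitary_mul_star
  have hzs : (star (1 + star B * (A - B))).IsFredholm :=
    isFredholm_of_dot_unitary (by rwa [dot_star, star_star]) (by rwa [dot_star, star_star])
  have hc := norm_star_unitary_mul_corner_sub_one_lt hb
    (isStarProjection_dot_starProjection (U := U)) hd.isProjDecomposition hε
  rw [← dot_one_add_star_mul_sub] at hc
  have h3 := isFredholm_and_ind_eq_neg hzs (S := 1 + star B * (A - B))
    (by rw [dot_star, h₁, sub_self, norm_zero]; exact one_pos)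
  have h4 := isFredholm_and_ind_eq_neg hzs
    (S := U.starProjection * (1 + star B * (A - B)) * U.starProjection + (1 - U.starProjection))
    (by simpa only [dot_star, dot_add, dot_mul, dot_sub, dot_one] using hc)
  exact ⟨h4.1, h4.2.trans h3.2.symm⟩

/-- `C⋆A` and `C⋆B` are Fredholm, and their indices differ by the index of `1 + B⋆(A - B)`:
composing `C⋆B` with the corner of `1 + B⋆(A - B)` yields `C⋆A` up to a small error. -/
lemma isFredholm_compressed (h : IsKBalanced A B) (hε : ε < 1 / 20)
    (hd : IsDecomposition A B ε U) (hC : IsAuxiliary A B ε U C) :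
    (compressed U C A).IsFredholm ∧ (compressed U C B).IsFredholm ∧
      relInd A B U C = ind (1 + star B * (A - B)) := by
  have hA := isFredholm_extendedCompressed h.norm_left hε hd hC.1
  have hB := isFredholm_extendedCompressed h.norm_right hε hd.symm hC.2
  have hZ := isFredholm_corner_unitary h hε hd
  have hA' := isFredholm_and_ind_of_extend extendedCompressed_eq hA.1
  have hB' := isFredholm_and_ind_of_extend extendedCompressed_eq hB.1
  refine ⟨hA'.1, hB'.1, ?_⟩
  have hc := norm_star_parametrix_mul_compressed_mul_corner_sub_one_lt h.isBalanced
    (isStarProjection_dot_starProjection (U := U)) hd.isProjDecomposition hε hC.1.isProjAdmissible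
  have h1 := isFredholm_and_ind_eq_neg (isFredholm_star_parametrix h.norm_left hε hC.1)
    (S := extendedCompressed U C B * (U.starProjection * (1 + star B * (A - B)) * U.starProjection +
      (1 - U.starProjection)))
    (by simpa only [extendedCompressed, parametrix, dot_star, dot_add, dot_mul, dot_sub, dot_one]
      using hc)
  have h2 := ind_mul hB.1 hZ.1
  rw [relInd, hA'.2, hB'.2]
  linarith [h1.2, hA.2, hZ.2]

end Corner

end BalancedPair

end

theorem mainTheorem4 {H : Type*} [NormedAddCommGroup H] [InnerProductSpace ℂ H] [CompleteSpace H]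
    (A B : H →L[ℂ] H) (hAB : BalancedPair.IsKBalanced A B) :
    -- auxiliary operators exist, and the operators entering the relative index are Fredholm
    (∀ (ε : ℝ), 0 < ε → ε < 1 / 20 → ∀ (U : Submodule ℂ H) [CompleteSpace U],
      BalancedPair.IsDecomposition A B ε U →
        BalancedPair.IsAuxiliary A B ε U (BalancedPair.restr U A) ∧
        BalancedPair.IsAuxiliary A B ε U (BalancedPair.restr U B) ∧
        ∀ C : U →L[ℂ] H, BalancedPair.IsAuxiliary A B ε U C →
          (BalancedPair.compressed U C A).IsFredholm ∧
          (BalancedPair.compressed U C B).IsFredholm) ∧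
    -- the relative index depends neither on the auxiliary operator nor on the decomposition
    (∀ (ε ε' : ℝ), 0 < ε → ε < 1 / 20 → 0 < ε' → ε' < 1 / 20 →
      ∀ (U U' : Submodule ℂ H) [CompleteSpace U] [CompleteSpace U'],
        BalancedPair.IsDecomposition A B ε U → BalancedPair.IsDecomposition A B ε' U' →
        ∀ (C : U →L[ℂ] H) (C' : U' →L[ℂ] H),
          BalancedPair.IsAuxiliary A B ε U C → BalancedPair.IsAuxiliary A B ε' U' C' →
            BalancedPair.relInd A B U C = BalancedPair.relInd A B U' C') ∧
    -- it is the index of the Fredholm operator `1 + B*(A - B)`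
    (1 + star B * (A - B)).IsFredholm ∧
    (∀ (ε : ℝ), 0 < ε → ε < 1 / 20 → ∀ (U : Submodule ℂ H) [CompleteSpace U],
      BalancedPair.IsDecomposition A B ε U →
        ∀ C : U →L[ℂ] H, BalancedPair.IsAuxiliary A B ε U C →
          BalancedPair.relInd A B U C = BalancedPair.ind (1 + star B * (A - B))) := by
  refine ⟨fun ε h0 hε U _ hd => ?_, fun ε ε' _ hε _ hε' U U' _ _ hd hd' C C' hC hC' => ?_,
    BalancedPair.isFredholm_unitary hAB, fun ε _ hε U _ hd C hC => ?_⟩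
  · refine ⟨⟨BalancedPair.isAdmissibleFor_self h0,
      BalancedPair.isAdmissibleFor_restr hAB.symm hε hd.symm⟩,
      ⟨BalancedPair.isAdmissibleFor_restr hAB hε hd, BalancedPair.isAdmissibleFor_self h0⟩,
      fun C hC => ?_⟩
    obtain ⟨hA, hB, -⟩ := BalancedPair.isFredholm_compressed hAB hε hd hC
    exact ⟨hA, hB⟩
  · rw [(BalancedPair.isFredholm_compressed hAB hε hd hC).2.2,
      (BalancedPair.isFredholm_compressed hAB hε' hd' hC').2.2]
  · exact (BalancedPair.isFredholm_compressed hAB hε hd hC).2.2
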